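/- Let $X$ be a rotationally invariant log-concave random vector in $\mathbb{R}^n$ (that is, its law $\mu_X$ is invariant under all linear isometries and satisfies $\mu_X((1-\lambda)A+\lambda B)\ge \mu_X(A)^{1-\lambda}\mu_X(B)^{\lambda}$ for all Borel sets $A,B\subset\mathbb{R}^n$ and $\lambda\in(0,1)$), with a density of the form $x\mapsto f(|x|)$ with respect to Lebesgue measure, where $f\ge 0$ on $(0,\infty)$. For a random vector $Y$ in $\mathbb{R}^n$ let \[ \Lambda_Y(\xi)=\log\mathbb{E}\,e^{\langle Y,\xi\rangle}\in(-\infty,\infty],\qquad \Lambda_Y^*(x)=\sup_{\xi\in\mathbb{R}^n}\bigl(\langle x,\xi\rangle-\Lambda_Y(\xi)\bigr)\in[0,\infty] \] be its cumulant generating function and its Cramér transform (with $e^{-\infty}=0$), and let $G$ be a standard Gaussian random vector in $\mathbb{R}^n$. Then: 1. if $x\mapsto f(\sqrt{x})$ is log-convex on $(0,\infty)$, then $\mathbb{E}\,e^{-\Lambda_X^*(X)}\ge \mathbb{E}\,e^{-\Lambda_G^*(G)}$; 2. if $x\mapsto f(\sqrt{x})$ is log-concave on $(0,\infty)$, then $\mathbb{E}\,e^{-\Lambda_X^*(X)}\le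 \mathbb{E}\,e^{-\Lambda_G^*(G)}$; 3. $\mathbb{E}\,e^{-\Lambda_G^*(G)}=2^{-n/2}$; consequently $\mathbb{E}\,e^{-\Lambda_X^*(X)}\le 2^{-n/2}$ whenever $x\mapsto f(\sqrt{x})$ is log-concave on $(0,\infty)$. -/

import Mathlib

open MeasureTheory ProbabilityTheory
open scoped ENNReal Pointwise

noncomputable section

/-- The cumulant generating function (log-Laplace transform)
`Λ_μ(ξ) = log 𝔼_μ e^{⟨X, ξ⟩}`, with the value `⊤` where the expectation is infinite. -/
def cumulantGen {E : Type*} [NormedAddCommGroup E] [InnerProductSpace ℝ E] [MeasurableSpace E]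
    (μ : Measure E) (ξ : E) : EReal :=
  ENNReal.log (∫⁻ x, ENNReal.ofReal (Real.exp (inner ℝ x ξ)) ∂μ)

/-- The Cramér transform `Λ*_μ(x) = sup_ξ (⟨x, ξ⟩ - Λ_μ(ξ))`, with values in the extended reals. -/
def cramerTransform {E : Type*} [NormedAddCommGroup E] [InnerProductSpace ℝ E]
    [MeasurableSpace E] (μ : Measure E) (x : E) : EReal :=
  ⨆ ξ : E, (((inner ℝ x ξ : ℝ) : EReal) - cumulantGen μ ξ)

/-- The expectation `𝔼 e^{-Λ*_X(X)}` for a random vector `X` on `(Ω, P)`, where `Λ*_X` is the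
Cramér transform of the law of `X` and `e^{-∞} = 0`. The integrand is nonnegative, so the
expectation is a Lebesgue integral in `[0, ∞]`. -/
def expectedExpNegCramer {E : Type*} [NormedAddCommGroup E] [InnerProductSpace ℝ E]
    [MeasurableSpace E] {Ω : Type*} [MeasurableSpace Ω] (P : Measure Ω) (X : Ω → E) : ℝ≥0∞ :=
  ∫⁻ ω, EReal.exp (-cramerTransform (P.map X) (X ω)) ∂P

/-- A Borel measure is log-concave if `μ((1-t)A + tB) ≥ μ(A)^{1-t} μ(B)^t` for all measurable
`A`, `B` and all `t ∈ (0, 1)`. -/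
def IsLogConcaveMeasure {E : Type*} [NormedAddCommGroup E] [InnerProductSpace ℝ E]
    [MeasurableSpace E] (μ : Measure E) : Prop :=
  ∀ A B : Set E, MeasurableSet A → MeasurableSet B → ∀ t : ℝ, 0 < t → t < 1 →
    μ A ^ (1 - t) * μ B ^ t ≤ μ ((1 - t) • A + t • B)

/-- A measure is rotationally invariant if it is preserved by all linear isometries. -/
def IsRotationallyInvariant {E : Type*} [NormedAddCommGroup E] [InnerProductSpace ℝ E]
    [MeasurableSpace E] (μ : Measure E) : Prop :=
  ∀ U : E ≃ₗᵢ[ℝ] E, μ.map U = μ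

/-- A nonnegative function `g` is log-concave on `(0, ∞)`; zeros are allowed (`log 0 = -∞`). -/
def IsLogConcaveOnPos (g : ℝ → ℝ) : Prop :=
  (∀ x, 0 < x → 0 ≤ g x) ∧
    ∀ x y t : ℝ, 0 < x → 0 < y → 0 < t → t < 1 →
      g x ^ (1 - t) * g y ^ t ≤ g ((1 - t) * x + t * y)

/-- A nonnegative function `g` is log-convex on `(0, ∞)`. -/
def IsLogConvexOnPos (g : ℝ → ℝ) : Prop :=
  (∀ x, 0 < x → 0 ≤ g x) ∧
    ∀ x y t : ℝ, 0 < x → 0 < y → 0 < t → t < 1 →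
      g ((1 - t) * x + t * y) ≤ g x ^ (1 - t) * g y ^ t

/-- The class of `f` (only its values on `(0, ∞)` matter) such that `x ↦ f(√x)` is log-concave
on `(0, ∞)`. -/
def LCconc : Set (ℝ → ℝ) := {f | IsLogConcaveOnPos fun x => f (Real.sqrt x)}

/-- The class of `f` (only its values on `(0, ∞)` matter) such that `x ↦ f(√x)` is log-convex
on `(0, ∞)`. -/
def LCconv : Set (ℝ → ℝ) := {f | IsLogConvexOnPos fun x => f (Real.sqrt x)}

/-- The random vector `X` has the radial density `x ↦ f(|x|)` with respect to Lebesgue measure. -/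
def HasRadialDensity {n : ℕ} {Ω : Type*} [MeasurableSpace Ω] (P : Measure Ω)
    (X : Ω → EuclideanSpace ℝ (Fin n)) (f : ℝ → ℝ) : Prop :=
  P.map X = (volume : Measure (EuclideanSpace ℝ (Fin n))).withDensity
    fun x => ENNReal.ofReal (f ‖x‖)

end

/-! The proof compares `X` with a centred Gaussian `G_b` of density proportional to `exp (-b ‖x‖ ^
2)`, where `b` is chosen so that the second moments agree. In the variable `t = ‖x‖ ^ 2` the
logarithm of the Gaussian profile is affine. So if the profile `g t = f √t` is log-concave, the set
where it dominates the Gaussian one is an interval. With equal mass and equal second moment, this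
sign pattern gives the convex order `𝔼 φ(‖X‖ ^ 2) ≤ 𝔼 φ(‖G_b‖ ^ 2)` for nonnegative convex `φ`
(`lintegral_convexOn_comp_mul_le`, `RadialConvexLE.of_ordConnected`).

The convex order is used twice. Averaged over directions, `exp ⟨x, ξ⟩` becomes a mixture of the
convex functions `t ↦ cosh (c √t)`, so `𝔼 exp ⟨X, ξ⟩ ≤ exp (‖ξ‖ ^ 2 / (4 b))` and hence `Λ*_X(x) ≥ b
‖x‖ ^ 2`. Then `φ t = exp (-b t)` gives `𝔼 exp (-Λ*_X(X)) ≤ 𝔼 exp (-b ‖X‖ ^ 2) ≤ 𝔼 exp (-b ‖G_b‖ ^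
2) = 2 ^ (-n / 2)`, a value independent of `b`. Both steps point the same way, and both reverse for
log-convex `g`.

Matching second moments requires them to be finite. For log-concave `g` this is automatic, by an
exponential tail bound. For log-convex `g` it may fail, but then every exponential moment with `ξ ≠
0` is infinite, so `exp (-Λ*_X) ≥ 1` everywhere. -/

/-! ### Convex ordering from sign changes of densities -/

section ConvexOrder

variable {α : Type*} [MeasurableSpace α] {μ : Measure α} {s p q : α → ℝ} {φ : ℝ → ℝ}

/-- The three-chord inequality without denominators. -/
lemma ConvexOn.mul_le_chord {S : Set ℝ} (hφ : ConvexOn ℝ S φ) {x y z : ℝ} (hx : x ∈ S)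
    (hz : z ∈ S) (hxy : x ≤ y) (hyz : y ≤ z) :
    (z - x) * φ y ≤ (z - y) * φ x + (y - x) * φ z := by
  rcases eq_or_lt_of_le (hxy.trans hyz) with h | h
  · obtain rfl : x = y := le_antisymm hxy (h ▸ hyz)
    simp [h]
  have hd : 0 < z - x := sub_pos.2 h
  have key := hφ.2 hx hz (div_nonneg (sub_nonneg.2 hyz) hd.le)
    (div_nonneg (sub_nonneg.2 hxy) hd.le) (by field_simp; ring)
  have e : ((z - y) / (z - x)) • x + ((y - x) / (z - x)) • z = y := by
    simp only [smul_eq_mul]; field_simp; ring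
  rw [e, smul_eq_mul, smul_eq_mul] at key
  calc (z - x) * φ y ≤ (z - x) * ((z - y) / (z - x) * φ x + (y - x) / (z - x) * φ z) := by gcongr
    _ = _ := by field_simp

/-- If an affine function separates `φ` according to the sign of `p - q`, and `p`, `q` have equal
zeroth and first moments in `s`, then `φ` has a smaller integral against `p`. -/
lemma lintegral_comp_mul_le_of_affine (hs : Measurable s) (hs0 : ∀ x, 0 ≤ s x)
    (hp : Integrable p μ) (hq : Integrable q μ) (hp0 : ∀ x, 0 ≤ p x) (hq0 : ∀ x, 0 ≤ q x)
    (hsp : Integrable (fun x => s x * p x) μ) (hsq : Integrable (fun x => s x * q x) μ)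
    (hmass : ∫ x, p x ∂μ = ∫ x, q x ∂μ) (hmom : ∫ x, s x * p x ∂μ = ∫ x, s x * q x ∂μ)
    (hφm : Measurable φ) (hφ0 : ∀ t, 0 ≤ t → 0 ≤ φ t) {κ a b : ℝ} (hκ : 0 < κ)
    (h : ∀ᵐ x ∂μ, (κ * φ (s x) - (a + b * s x)) * (p x - q x) ≤ 0) :
    ∫⁻ x, ENNReal.ofReal (φ (s x) * p x) ∂μ ≤ ∫⁻ x, ENNReal.ofReal (φ (s x) * q x) ∂μ := by
  by_cases htop : ∫⁻ x, ENNReal.ofReal (φ (s x) * q x) ∂μ = ∞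
  · rw [htop]; exact le_top
  have hnq : ∀ x, 0 ≤ φ (s x) * q x := fun x => mul_nonneg (hφ0 _ (hs0 x)) (hq0 x)
  have hnp : ∀ x, 0 ≤ φ (s x) * p x := fun x => mul_nonneg (hφ0 _ (hs0 x)) (hp0 x)
  have hφs : AEStronglyMeasurable (fun x => φ (s x)) μ := (hφm.comp hs).aestronglyMeasurable
  have hiq : Integrable (fun x => φ (s x) * q x) μ := by
    refine ⟨hφs.mul hq.1, ?_⟩
    rw [hasFiniteIntegral_iff_ofReal (Filter.Eventually.of_forall hnq)]
    exact lt_top_iff_ne_top.2 htop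
  have hpq : Integrable (fun x => p x - q x) μ := hp.sub hq
  have hspq : Integrable (fun x => s x * p x - s x * q x) μ := hsp.sub hsq
  have hiA : Integrable (fun x => κ⁻¹ * (a * (p x - q x) + b * (s x * p x - s x * q x))) μ :=
    ((hpq.const_mul a).add (hspq.const_mul b)).const_mul κ⁻¹
  -- This bound serves twice: it dominates `φ p` by an integrable function, and its affine part
  -- integrates to zero because the moments agree.
  have hle : ∀ᵐ x ∂μ, φ (s x) * p x ≤
      φ (s x) * q x + κ⁻¹ * (a * (p x - q x) + b * (s x * p x - s x * q x)) := by
    filter_upwards [h] with x hx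
    have : κ⁻¹ * ((κ * φ (s x) - (a + b * s x)) * (p x - q x)) ≤ 0 :=
      mul_nonpos_of_nonneg_of_nonpos (inv_nonneg.2 hκ.le) hx
    have e : κ⁻¹ * ((κ * φ (s x) - (a + b * s x)) * (p x - q x)) = φ (s x) * p x - φ (s x) * q x -
        κ⁻¹ * (a * (p x - q x) + b * (s x * p x - s x * q x)) := by
      field_simp
    linarith
  have hip : Integrable (fun x => φ (s x) * p x) μ := by
    refine (hiq.add hiA).mono' (hφs.mul hp.1) ?_
    filter_upwards [hle] with x hx
    rw [Real.norm_of_nonneg (hnp x)]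
    exact hx
  rw [← ofReal_integral_eq_lintegral_ofReal hip (Filter.Eventually.of_forall hnp),
    ← ofReal_integral_eq_lintegral_ofReal hiq (Filter.Eventually.of_forall hnq)]
  refine ENNReal.ofReal_le_ofReal ((integral_mono_ae hip (hiq.add hiA) hle).trans_eq ?_)
  have e : ∫ x, κ⁻¹ * (a * (p x - q x) + b * (s x * p x - s x * q x)) ∂μ = 0 := by
    rw [integral_const_mul, integral_add (hpq.const_mul a) (hspq.const_mul b),
      integral_const_mul, integral_const_mul, integral_sub hp hq, integral_sub hsp hsq, hmass, hmom]
    simp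
  simp only [Pi.add_apply]
  rw [integral_add hiq hiA, e, add_zero]

/-- Convex ordering: if `p ≥ q` exactly when `s` lies in an interval `I`, and `p`, `q` have equal
zeroth and first moments in `s`, then every nonnegative convex function of `s` has a smaller
integral against `p` than against `q`. -/
lemma lintegral_convexOn_comp_mul_le (hs : Measurable s) (hs0 : ∀ x, 0 ≤ s x)
    (hnull : ∀ t, ∀ᵐ x ∂μ, s x ≠ t)
    (hp : Integrable p μ) (hq : Integrable q μ) (hp0 : ∀ x, 0 ≤ p x) (hq0 : ∀ x, 0 ≤ q x)
    (hsp : Integrable (fun x => s x * p x) μ) (hsq : Integrable (fun x => s x * q x) μ)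
    (hmass : ∫ x, p x ∂μ = ∫ x, q x ∂μ) (hmom : ∫ x, s x * p x ∂μ = ∫ x, s x * q x ∂μ)
    {I : Set ℝ} (hI : I.OrdConnected) (hin : ∀ᵐ x ∂μ, s x ∈ I → q x ≤ p x)
    (hout : ∀ᵐ x ∂μ, s x ∉ I → p x ≤ q x)
    (hφm : Measurable φ) (hφ0 : ∀ t, 0 ≤ t → 0 ≤ φ t) (hφ : ConvexOn ℝ (Set.Ici 0) φ) :
    ∫⁻ x, ENNReal.ofReal (φ (s x) * p x) ∂μ ≤ ∫⁻ x, ENNReal.ofReal (φ (s x) * q x) ∂μ := by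
  -- Cutting `I` down to `[0, ∞)` makes it bounded below and keeps its endpoints where `φ` is
  -- convex.
  have hJ : (I ∩ Set.Ici 0).OrdConnected := hI.inter Set.ordConnected_Ici
  have hJI : ∀ x, s x ∉ I ∩ Set.Ici 0 → s x ∉ I := fun x hx h => hx ⟨h, hs0 x⟩
  have hJ0 : BddBelow (I ∩ Set.Ici 0) := ⟨0, fun t ht => ht.2⟩
  generalize hJdef : I ∩ Set.Ici (0 : ℝ) = J at hJ hJI hJ0
  have hin' : ∀ᵐ x ∂μ, s x ∈ J → q x ≤ p x := by
    filter_upwards [hin] with x hx hxJ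
    rw [← hJdef] at hxJ
    exact hx hxJ.1
  have hout' : ∀ᵐ x ∂μ, s x ∉ J → p x ≤ q x := by
    filter_upwards [hout] with x hx hxJ using hx (hJI x hxJ)
  have hJnn : ∀ t ∈ J, 0 ≤ t := fun t ht => by rw [← hJdef] at ht; exact ht.2
  by_cases hsub : J.Subsingleton
  · refine lintegral_mono_ae ?_
    have hne : ∀ᵐ x ∂μ, s x ∉ J := by
      rcases hsub.eq_empty_or_singleton with h | ⟨t, h⟩
      · simp [h]
      · simpa [h] using hnull t
    filter_upwards [hne, hout'] with x hx hx'
    exact ENNReal.ofReal_le_ofReal (mul_le_mul_of_nonneg_left (hx' hx) (hφ0 _ (hs0 x)))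
  rw [Set.not_subsingleton_iff] at hsub
  obtain ⟨u, hu, v, hv, huv⟩ := hsub.exists_lt
  have hbelow : ∀ t, t < sInf J → t ∉ J := fun t ht h => (csInf_le hJ0 h).not_gt ht
  have ha0 : 0 ≤ sInf J := le_csInf ⟨u, hu⟩ hJnn
  by_cases hbdd : BddAbove J
  · have habove : ∀ t, sSup J < t → t ∉ J := fun t ht h => (le_csSup hbdd h).not_gt ht
    have hab : sInf J < sSup J := (csInf_le hJ0 hu).trans_lt (huv.trans_le (le_csSup hbdd hv))
    have hmid : ∀ t, sInf J < t → t < sSup J → t ∈ J := by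
      intro t h1 h2
      obtain ⟨c, hc, hct⟩ := exists_lt_of_csInf_lt ⟨u, hu⟩ h1
      obtain ⟨d, hd, htd⟩ := exists_lt_of_lt_csSup ⟨u, hu⟩ h2
      exact hJ.out hc hd ⟨hct.le, htd.le⟩
    generalize sInf J = a at *
    generalize sSup J = b at *
    -- The affine function is the chord of `φ` over `[a, b]`, multiplied by `κ = b - a` to clear
    -- denominators. `φ` lies below the chord inside the interval and above it outside, opposite to
    -- the sign of `p - q`.
    refine lintegral_comp_mul_le_of_affine hs hs0 hp hq hp0 hq0 hsp hsq hmass hmom hφm hφ0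
      (κ := b - a) (a := b * φ a - a * φ b) (b := φ b - φ a) (sub_pos.2 hab) ?_
    have hbmem : b ∈ Set.Ici (0 : ℝ) := ha0.trans hab.le
    filter_upwards [hin', hout', hnull a, hnull b] with x h1 h2 h3 h4
    rcases lt_or_gt_of_ne h3 with h | h
    · have := hφ.mul_le_chord (hs0 x) hbmem h.le hab.le
      have hpq := h2 (hbelow _ h)
      exact mul_nonpos_of_nonneg_of_nonpos (by nlinarith) (by linarith)
    rcases lt_or_gt_of_ne h4 with h' | h'
    · have := hφ.mul_le_chord (Set.mem_Ici.2 ha0) hbmem h.le h'.le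
      have hpq := h1 (hmid _ h h')
      exact mul_nonpos_of_nonpos_of_nonneg (by nlinarith) (by linarith)
    · have := hφ.mul_le_chord (Set.mem_Ici.2 ha0) (hs0 x) hab.le h'.le
      have hpq := h2 (habove _ h')
      exact mul_nonpos_of_nonneg_of_nonpos (by nlinarith) (by linarith)
  · have habove : ∀ t, sInf J < t → t ∈ J := by
      intro t ht
      obtain ⟨c, hc, hct⟩ := exists_lt_of_csInf_lt ⟨u, hu⟩ ht
      obtain ⟨d, hd, htd⟩ := not_bddAbove_iff.1 hbdd t
      exact hJ.out hc hd ⟨hct.le, htd.le⟩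
    generalize sInf J = a at *
    -- With a single sign change at `a`, `(s - a) (p - q)` is nonnegative and has zero integral, so
    -- `p = q` almost everywhere.
    have hnn : 0 ≤ᵐ[μ] fun x => (s x * p x - s x * q x) - a * (p x - q x) := by
      filter_upwards [hin', hout', hnull a] with x h1 h2 h3
      have e : (s x * p x - s x * q x) - a * (p x - q x) = (s x - a) * (p x - q x) := by ring
      simp only [Pi.zero_apply, e]
      rcases lt_or_gt_of_ne h3 with h | h
      · have := h2 (hbelow _ h)
        exact mul_nonneg_of_nonpos_of_nonpos (by linarith) (by linarith)
      · have := h1 (habove _ h)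
        exact mul_nonneg (by linarith) (by linarith)
    have hpq : Integrable (fun x => p x - q x) μ := hp.sub hq
    have hspq : Integrable (fun x => s x * p x - s x * q x) μ := hsp.sub hsq
    have hint : Integrable (fun x => (s x * p x - s x * q x) - a * (p x - q x)) μ :=
      hspq.sub (hpq.const_mul a)
    have hzero : ∫ x, (s x * p x - s x * q x) - a * (p x - q x) ∂μ = 0 := by
      rw [integral_sub hspq (hpq.const_mul a), integral_const_mul,
        integral_sub hp hq, integral_sub hsp hsq, hmass, hmom]
      simp
    have hae := (integral_eq_zero_iff_of_nonneg_ae hnn hint).1 hzero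
    refine (lintegral_congr_ae ?_).le
    filter_upwards [hae, hnull a] with x h1 h2
    have e : (s x - a) * (p x - q x) = 0 := by
      simp only [Pi.zero_apply] at h1; linarith
    rcases mul_eq_zero.1 e with h | h
    · exact absurd (sub_eq_zero.1 h) h2
    · simp only [sub_eq_zero.1 h]

end ConvexOrder

/-- `t ↦ cosh (c √t)` is convex, being a power series with nonnegative coefficients. -/
lemma convexOn_cosh_mul_sqrt (c : ℝ) :
    ConvexOn ℝ (Set.Ici 0) fun t => Real.cosh (c * √t) := by
  have hsum : ∀ t : ℝ, 0 ≤ t →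
      HasSum (fun k : ℕ => c ^ (2 * k) / (2 * k).factorial * t ^ k) (Real.cosh (c * √t)) := by
    intro t ht
    convert Real.hasSum_cosh (c * √t) using 2 with k
    rw [mul_pow, pow_mul √t, Real.sq_sqrt ht]; ring
  refine ⟨convex_Ici 0, fun x hx y hy a b ha hb hab => ?_⟩
  have hxy : 0 ≤ a • x + b • y := (convex_Ici (0 : ℝ)) hx hy ha hb hab
  refine hasSum_le (fun k => ?_) (hsum _ hxy)
    (((hsum x hx).mul_left a).add ((hsum y hy).mul_left b))
  have h := (convexOn_pow (𝕜 := ℝ) k).2 hx hy ha hb hab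
  have hc : 0 ≤ c ^ (2 * k) / ((2 * k).factorial : ℝ) := by
    rw [pow_mul]; positivity
  calc c ^ (2 * k) / ((2 * k).factorial : ℝ) * (a • x + b • y) ^ k
      ≤ c ^ (2 * k) / ((2 * k).factorial : ℝ) * (a • x ^ k + b • y ^ k) := by gcongr
    _ = _ := by simp only [smul_eq_mul]; ring

/-- `t ↦ exp (-b t)` is convex. -/
lemma convexOn_exp_neg_mul (b : ℝ) : ConvexOn ℝ (Set.Ici 0) fun t => Real.exp (-b * t) :=
  (convexOn_exp.comp_linearMap (LinearMap.mulLeft ℝ (-b))).subset (Set.subset_univ _)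
    (convex_Ici 0)

/-! ### Averaging over the sphere -/

section Polar

variable {E : Type*} [NormedAddCommGroup E] [InnerProductSpace ℝ E] [FiniteDimensional ℝ E]
  [MeasurableSpace E] [BorelSpace E]

/-- Integration in polar coordinates for nonnegative functions. -/
lemma lintegral_eq_lintegral_toSphere [Nontrivial E] {H : E → ℝ≥0∞} (hH : Measurable H) :
    ∫⁻ x, H x = ∫⁻ θ, ∫⁻ r, H ((r : ℝ) • (θ : E))
      ∂(Measure.volumeIoiPow (Module.finrank ℝ E - 1)) ∂(volume : Measure E).toSphere := by
  have hmp := (volume : Measure E).measurePreserving_homeomorphUnitSphereProd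
  have hm : Measurable fun z : Metric.sphere (0 : E) 1 × Set.Ioi (0 : ℝ) =>
      H ((z.2 : ℝ) • (z.1 : E)) := hH.comp (by fun_prop)
  rw [← lintegral_prod _ hm.aemeasurable, ← hmp.lintegral_comp hm]
  have hset : MeasurableSet ({0}ᶜ : Set E) := (measurableSet_singleton _).compl
  have e : ∀ x : ({0}ᶜ : Set E), H (((homeomorphUnitSphereProd E x).2 : ℝ) •
      ((homeomorphUnitSphereProd E x).1 : E)) = H x := by
    intro x
    have h := homeomorphUnitSphereProd_symm_apply_coe E (homeomorphUnitSphereProd E x)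
    rw [Homeomorph.symm_apply_apply] at h
    rw [← h]
  simp_rw [e]
  rw [lintegral_subtype_comap hset, restrict_compl_singleton]

/-- Replacing the direction of the variable by an independent uniform direction. -/
lemma toSphere_univ_mul_lintegral [Nontrivial E] {H : E → ℝ≥0∞} (hH : Measurable H) :
    (volume : Measure E).toSphere Set.univ * ∫⁻ x, H x =
      ∫⁻ θ, (∫⁻ x : E, H (‖x‖ • (θ : E))) ∂(volume : Measure E).toSphere := by
  have inner_eq : ∀ θ : Metric.sphere (0 : E) 1, ∫⁻ x : E, H (‖x‖ • (θ : E)) =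
      (volume : Measure E).toSphere Set.univ * ∫⁻ r, H ((r : ℝ) • (θ : E))
        ∂(Measure.volumeIoiPow (Module.finrank ℝ E - 1)) := by
    intro θ
    rw [lintegral_eq_lintegral_toSphere (H := fun x => H (‖x‖ • (θ : E))) (hH.comp (by fun_prop))]
    have : ∀ (θ' : Metric.sphere (0 : E) 1) (r : Set.Ioi (0 : ℝ)),
        ‖(r : ℝ) • (θ' : E)‖ = r := by
      intro θ' r
      rw [norm_smul, norm_eq_of_mem_sphere, mul_one, Real.norm_of_nonneg r.2.out.le]
    simp_rw [this, lintegral_const]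
    rw [mul_comm]
  have hm : Measurable fun z : Metric.sphere (0 : E) 1 × Set.Ioi (0 : ℝ) =>
      H ((z.2 : ℝ) • (z.1 : E)) := hH.comp (by fun_prop)
  simp_rw [inner_eq]
  rw [lintegral_const_mul _ hm.lintegral_prod_right', ← lintegral_eq_lintegral_toSphere hH]

/-- The exponential moments of a radial density, averaged over directions. -/
lemma toSphere_univ_mul_lintegral_exp_inner [Nontrivial E] {g : ℝ → ℝ} (hg : Measurable g)
    (ξ : E) :
    (volume : Measure E).toSphere Set.univ *
        ∫⁻ x : E, ENNReal.ofReal (Real.exp (inner ℝ x ξ) * g (‖x‖ ^ 2)) =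
      ∫⁻ θ, (∫⁻ x : E,
          ENNReal.ofReal (Real.cosh (inner ℝ (θ : E) ξ * √(‖x‖ ^ 2)) * g (‖x‖ ^ 2)))
        ∂(volume : Measure E).toSphere := by
  have hm : ∀ F : E → ℝ, Measurable F → Measurable fun x : E =>
      ENNReal.ofReal (F x * g (‖x‖ ^ 2)) := fun F hF => by fun_prop
  have hneg : ∫⁻ x : E, ENNReal.ofReal (Real.exp (-inner ℝ x ξ) * g (‖x‖ ^ 2)) =
      ∫⁻ x : E, ENNReal.ofReal (Real.exp (inner ℝ x ξ) * g (‖x‖ ^ 2)) := by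
    have := lintegral_neg_eq_self (μ := (volume : Measure E))
      (fun x : E => ENNReal.ofReal (Real.exp (inner ℝ x ξ) * g (‖x‖ ^ 2)))
    simpa [inner_neg_left] using this
  -- Symmetrising under `x ↦ -x` replaces the exponential by `cosh`, which is convex in the squared
  -- radius.
  have hcosh : ∫⁻ x : E, ENNReal.ofReal (Real.exp (inner ℝ x ξ) * g (‖x‖ ^ 2)) =
      ∫⁻ x : E, ENNReal.ofReal (Real.cosh (inner ℝ x ξ) * g (‖x‖ ^ 2)) := by
    have e : ∀ x : E, ENNReal.ofReal (Real.cosh (inner ℝ x ξ) * g (‖x‖ ^ 2)) =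
        2⁻¹ * (ENNReal.ofReal (Real.exp (inner ℝ x ξ) * g (‖x‖ ^ 2)) +
          ENNReal.ofReal (Real.exp (-inner ℝ x ξ) * g (‖x‖ ^ 2))) := by
      intro x
      rw [ENNReal.ofReal_mul (Real.cosh_pos _).le, ENNReal.ofReal_mul (Real.exp_pos _).le,
        ENNReal.ofReal_mul (Real.exp_pos _).le, ← add_mul, ← mul_assoc,
        ← ENNReal.ofReal_add (Real.exp_pos _).le (Real.exp_pos _).le, Real.cosh_eq,
        ENNReal.ofReal_div_of_pos two_pos, ENNReal.div_eq_inv_mul]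
      simp
    simp_rw [e]
    rw [lintegral_const_mul _ (by fun_prop),
      lintegral_add_left (hm _ (by fun_prop)), hneg, ← two_mul, ← mul_assoc,
      ENNReal.inv_mul_cancel two_ne_zero ENNReal.ofNat_ne_top, one_mul]
  rw [hcosh, toSphere_univ_mul_lintegral (hm _ (by fun_prop))]
  refine lintegral_congr fun θ => lintegral_congr fun x => ?_
  rw [norm_smul, norm_eq_of_mem_sphere, mul_one, norm_norm, real_inner_smul_left,
    Real.sqrt_sq (norm_nonneg x), mul_comm ‖x‖]

end Polar

/-! ### Gaussian densities -/

section GaussianDensity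

variable {E : Type*} [NormedAddCommGroup E] [InnerProductSpace ℝ E]

variable (E) in
/-- The centred Gaussian density proportional to `exp (-b ‖x‖ ^ 2)` on `E`, as a function of
`‖x‖ ^ 2`. -/
noncomputable def gaussianProfile (b t : ℝ) : ℝ :=
  (b / Real.pi) ^ (Module.finrank ℝ E / 2 : ℝ) * Real.exp (-b * t)

lemma gaussianProfile_pos {b : ℝ} (hb : 0 < b) (t : ℝ) : 0 < gaussianProfile E b t := by
  have := Real.pi_pos
  unfold gaussianProfile; positivity

lemma measurable_gaussianProfile (b : ℝ) : Measurable (gaussianProfile E b) := by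
  unfold gaussianProfile; fun_prop

variable [FiniteDimensional ℝ E] [MeasurableSpace E] [BorelSpace E]

lemma integrable_exp_neg_mul_sq_norm {b : ℝ} (hb : 0 < b) :
    Integrable fun x : E => Real.exp (-b * ‖x‖ ^ 2) := by
  refine Integrable.of_integral_ne_zero ?_
  rw [GaussianFourier.integral_rexp_neg_mul_sq_norm hb]
  have := Real.pi_pos
  positivity

lemma integrable_sq_norm_mul_exp_neg_mul_sq_norm {b : ℝ} (hb : 0 < b) :
    Integrable fun x : E => ‖x‖ ^ 2 * Real.exp (-b * ‖x‖ ^ 2) := by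
  refine ((integrable_exp_neg_mul_sq_norm (E := E) (half_pos hb)).const_mul (2 / b)).mono'
    (by fun_prop) (Filter.Eventually.of_forall fun x => ?_)
  rw [Real.norm_of_nonneg (by positivity)]
  -- Half of the Gaussian exponent absorbs the factor `‖x‖ ^ 2`.
  have h1 : b / 2 * ‖x‖ ^ 2 ≤ Real.exp (b / 2 * ‖x‖ ^ 2) := by
    linarith [Real.add_one_le_exp (b / 2 * ‖x‖ ^ 2)]
  have h2 : Real.exp (-(b / 2) * ‖x‖ ^ 2) =
      Real.exp (b / 2 * ‖x‖ ^ 2) * Real.exp (-b * ‖x‖ ^ 2) := by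
    rw [← Real.exp_add]; ring_nf
  rw [h2, ← mul_assoc]
  gcongr
  calc ‖x‖ ^ 2 = 2 / b * (b / 2 * ‖x‖ ^ 2) := by field_simp
    _ ≤ _ := by gcongr

lemma integrable_gaussianProfile {b : ℝ} (hb : 0 < b) :
    Integrable fun x : E => gaussianProfile E b (‖x‖ ^ 2) :=
  (integrable_exp_neg_mul_sq_norm hb).const_mul _

lemma integrable_sq_norm_mul_gaussianProfile {b : ℝ} (hb : 0 < b) :
    Integrable fun x : E => ‖x‖ ^ 2 * gaussianProfile E b (‖x‖ ^ 2) := by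
  refine ((integrable_sq_norm_mul_exp_neg_mul_sq_norm (E := E) hb).const_mul
    ((b / Real.pi) ^ (Module.finrank ℝ E / 2 : ℝ))).congr (Filter.Eventually.of_forall fun x => ?_)
  simp only [gaussianProfile]; ring

lemma integral_gaussianProfile {b : ℝ} (hb : 0 < b) :
    ∫ x : E, gaussianProfile E b (‖x‖ ^ 2) = 1 := by
  have := Real.pi_pos
  simp only [gaussianProfile]
  rw [integral_const_mul, GaussianFourier.integral_rexp_neg_mul_sq_norm hb,
    ← Real.mul_rpow (by positivity) (by positivity)]
  rw [show b / Real.pi * (Real.pi / b) = 1 by field_simp, Real.one_rpow]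

/-- The second moment of the Gaussian densities, up to a constant that depends on `E` only. -/
lemma exists_integral_sq_norm_mul_gaussianProfile [Nontrivial E] :
    ∃ M : ℝ, 0 < M ∧
      ∀ b : ℝ, 0 < b → ∫ x : E, ‖x‖ ^ 2 * gaussianProfile E b (‖x‖ ^ 2) = M / b := by
  refine ⟨∫ x : E, ‖x‖ ^ 2 * gaussianProfile E 1 (‖x‖ ^ 2), ?_, fun b hb => ?_⟩
  · refine lt_of_le_of_ne (integral_nonneg fun x => ?_) fun h => ?_
    · exact mul_nonneg (by positivity) (gaussianProfile_pos one_pos _).le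
    · have h0 := (integral_eq_zero_iff_of_nonneg (fun x : E => mul_nonneg (by positivity)
        (gaussianProfile_pos one_pos _).le)
        (integrable_sq_norm_mul_gaussianProfile (E := E) one_pos)).1 h.symm
      have h1 : ∀ᵐ x : E, x ≠ 0 := by simp [ae_iff]
      obtain ⟨x, hx, hx'⟩ := (h0.and h1).exists
      have := gaussianProfile_pos (E := E) one_pos (‖x‖ ^ 2)
      have h2 : 0 < ‖x‖ ^ 2 := by positivity
      exact (mul_pos h2 this).ne' hx
  · have hpi := Real.pi_pos
    have h := Measure.integral_comp_smul_of_nonneg (volume : Measure E)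
      (fun x : E => ‖x‖ ^ 2 * gaussianProfile E 1 (‖x‖ ^ 2)) (√b) (hR := Real.sqrt_nonneg b)
    have e : ∀ x : E, ‖x‖ ^ 2 * gaussianProfile E b (‖x‖ ^ 2) =
        (b ^ (Module.finrank ℝ E / 2 : ℝ) / b) *
          (‖√b • x‖ ^ 2 * gaussianProfile E 1 (‖√b • x‖ ^ 2)) := by
      intro x
      rw [norm_smul, mul_pow, Real.norm_of_nonneg (Real.sqrt_nonneg b), Real.sq_sqrt hb.le]
      simp only [gaussianProfile]
      rw [Real.div_rpow hb.le hpi.le, Real.div_rpow zero_le_one hpi.le, Real.one_rpow,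
        show -1 * (b * ‖x‖ ^ 2) = -b * ‖x‖ ^ 2 by ring]
      field_simp
    have hpow : √b ^ Module.finrank ℝ E = b ^ (Module.finrank ℝ E / 2 : ℝ) := by
      rw [Real.sqrt_eq_rpow, ← Real.rpow_natCast, ← Real.rpow_mul hb.le]
      congr 1; ring
    simp_rw [e]
    rw [integral_const_mul, h, hpow, smul_eq_mul]
    have : 0 < b ^ (Module.finrank ℝ E / 2 : ℝ) := by positivity
    field_simp

/-- Completing the square turns the integrand into a multiple of the same Gaussian translated by `ξ
/ (2 b)`. -/
lemma lintegral_exp_inner_mul_gaussianProfile {b : ℝ} (hb : 0 < b) (ξ : E) :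
    ∫⁻ x : E, ENNReal.ofReal (Real.exp (inner ℝ x ξ) * gaussianProfile E b (‖x‖ ^ 2)) =
      ENNReal.ofReal (Real.exp (‖ξ‖ ^ 2 / (4 * b))) := by
  have e : ∀ x : E, Real.exp (inner ℝ x ξ) * gaussianProfile E b (‖x‖ ^ 2) =
      Real.exp (‖ξ‖ ^ 2 / (4 * b)) * gaussianProfile E b (‖x - (2 * b)⁻¹ • ξ‖ ^ 2) := by
    intro x
    simp only [gaussianProfile]
    rw [mul_left_comm, mul_left_comm (Real.exp (‖ξ‖ ^ 2 / (4 * b))), ← Real.exp_add,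
      ← Real.exp_add, norm_sub_sq_real, real_inner_smul_right, norm_smul,
      Real.norm_of_nonneg (by positivity)]
    congr 2
    field_simp
    ring
  simp_rw [e, ENNReal.ofReal_mul (Real.exp_pos _).le]
  rw [lintegral_const_mul' _ _ ENNReal.ofReal_ne_top,
    lintegral_sub_right_eq_self (fun x : E => ENNReal.ofReal (gaussianProfile E b (‖x‖ ^ 2))),
    ← ofReal_integral_eq_lintegral_ofReal (integrable_gaussianProfile hb)
      (Filter.Eventually.of_forall fun x => (gaussianProfile_pos hb _).le),
    integral_gaussianProfile hb, ENNReal.ofReal_one, mul_one]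

/-- The product is again Gaussian, with parameter `2 b`; the ratio of the normalising constants does
not depend on `b`. -/
lemma lintegral_exp_neg_mul_gaussianProfile {b : ℝ} (hb : 0 < b) :
    ∫⁻ x : E, ENNReal.ofReal (Real.exp (-b * ‖x‖ ^ 2) * gaussianProfile E b (‖x‖ ^ 2)) =
      (2 : ℝ≥0∞) ^ (-(Module.finrank ℝ E : ℝ) / 2) := by
  have hpi := Real.pi_pos
  have e : ∀ x : E, Real.exp (-b * ‖x‖ ^ 2) * gaussianProfile E b (‖x‖ ^ 2) =
      (2 : ℝ) ^ (-(Module.finrank ℝ E : ℝ) / 2) * gaussianProfile E (2 * b) (‖x‖ ^ 2) := by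
    intro x
    simp only [gaussianProfile]
    rw [mul_left_comm, ← Real.exp_add, mul_div_assoc 2 b, Real.mul_rpow two_pos.le (by positivity),
      ← mul_assoc, ← mul_assoc, ← Real.rpow_add two_pos,
      show -(Module.finrank ℝ E : ℝ) / 2 + (Module.finrank ℝ E : ℝ) / 2 = 0 by ring,
      Real.rpow_zero, one_mul]
    ring_nf
  simp_rw [e]
  simp_rw [ENNReal.ofReal_mul (Real.rpow_nonneg two_pos.le _)]
  rw [lintegral_const_mul' _ _ ENNReal.ofReal_ne_top,
    ← ofReal_integral_eq_lintegral_ofReal (integrable_gaussianProfile (by positivity))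
      (Filter.Eventually.of_forall fun x => (gaussianProfile_pos (by positivity) _).le),
    integral_gaussianProfile (by positivity), ENNReal.ofReal_one, mul_one,
    ← ENNReal.ofReal_rpow_of_pos two_pos]
  simp

variable (E) in
/-- The standard Gaussian measure has the density `(2π)^(-d/2) exp (-‖x‖ ^ 2 / 2)`. -/
lemma stdGaussian_eq_withDensity :
    stdGaussian E =
      volume.withDensity fun x : E => ENNReal.ofReal (gaussianProfile E (1 / 2) (‖x‖ ^ 2)) := by
  have hm : Measurable fun x : E => gaussianProfile E (1 / 2) (‖x‖ ^ 2) :=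
    (measurable_gaussianProfile _).comp (by fun_prop)
  have : IsFiniteMeasure (volume.withDensity fun x : E =>
      ENNReal.ofReal (gaussianProfile E (1 / 2) (‖x‖ ^ 2))) :=
    isFiniteMeasure_withDensity_ofReal (integrable_gaussianProfile (by norm_num)).2
  refine Measure.ext_of_charFun (funext fun t => ?_)
  rw [charFun_stdGaussian, charFun_apply, integral_withDensity_eq_integral_toReal_smul
    hm.ennreal_ofReal (Filter.Eventually.of_forall fun x => ENNReal.ofReal_lt_top)]
  have e : ∀ x : E, (ENNReal.ofReal (gaussianProfile E (1 / 2) (‖x‖ ^ 2))).toReal •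
      Complex.exp (inner ℝ x t * Complex.I) =
      (((1 / 2 / Real.pi : ℝ) ^ (Module.finrank ℝ E / 2 : ℝ) : ℝ) : ℂ) *
        Complex.exp (-((1 / 2 : ℝ) : ℂ) * ‖x‖ ^ 2 + Complex.I * inner ℝ t x) := by
    intro x
    rw [ENNReal.toReal_ofReal (gaussianProfile_pos (by norm_num) _).le, Complex.real_smul,
      gaussianProfile, Complex.ofReal_mul, mul_assoc, Complex.ofReal_exp, ← Complex.exp_add,
      real_inner_comm]
    push_cast
    ring_nf
  simp_rw [e]
  have hpi := Real.pi_pos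
  rw [integral_const_mul, GaussianFourier.integral_cexp_neg_mul_sq_norm_add (by norm_num),
    ← mul_assoc]
  have hc : ((Real.pi : ℂ) / ((1 / 2 : ℝ) : ℂ)) ^ ((Module.finrank ℝ E : ℂ) / 2) =
      (((Real.pi / (1 / 2)) ^ (Module.finrank ℝ E / 2 : ℝ) : ℝ) : ℂ) := by
    rw [Complex.ofReal_cpow (by positivity)]
    push_cast
    rfl
  rw [hc, ← Complex.ofReal_mul, ← Real.mul_rpow (by positivity) (by positivity),
    show 1 / 2 / Real.pi * (Real.pi / (1 / 2)) = 1 by field_simp, Real.one_rpow]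
  simp only [Complex.ofReal_one, one_mul, Complex.I_sq]
  push_cast
  ring_nf

end GaussianDensity

/-! ### Log-concave and log-convex profiles against Gaussian profiles -/

section Profiles

variable {g : ℝ → ℝ} {C : ℝ}

lemma rpow_mul_rpow_const_mul_exp (hC : 0 ≤ C) (b x y : ℝ) (t : ℝ) :
    (C * Real.exp (-b * x)) ^ (1 - t) * (C * Real.exp (-b * y)) ^ t =
      C * Real.exp (-b * ((1 - t) * x + t * y)) := by
  rw [Real.mul_rpow hC (Real.exp_pos _).le, Real.mul_rpow hC (Real.exp_pos _).le,
    ← Real.exp_mul, ← Real.exp_mul, mul_mul_mul_comm, ← Real.exp_add,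
    ← Real.rpow_add' hC (by norm_num)]
  rw [sub_add_cancel, Real.rpow_one]
  ring_nf

/-- A point strictly between `x` and `y` as a convex combination. -/
lemma exists_convex_comb_of_mem_Ioo {x y z : ℝ} (hz : z ∈ Set.Ioo x y) :
    ∃ t : ℝ, 0 < t ∧ t < 1 ∧ (1 - t) * x + t * y = z := by
  have h : 0 < y - x := sub_pos.2 (hz.1.trans hz.2)
  refine ⟨(z - x) / (y - x), div_pos (sub_pos.2 hz.1) h, ?_, ?_⟩
  · rw [div_lt_one h]; linarith [hz.2]
  · field_simp; ring

/-- Weighted geometric means of `C * exp (-b t)` are exact, so the inequality at two points passes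
to every point between them. -/
lemma IsLogConcaveOnPos.ordConnected_const_mul_exp_le (hg : IsLogConcaveOnPos g) (hC : 0 ≤ C)
    (b : ℝ) : {t | 0 < t ∧ C * Real.exp (-b * t) ≤ g t}.OrdConnected := by
  refine Set.ordConnected_of_Ioo fun x hx y hy _ z hz => ⟨hx.1.trans hz.1, ?_⟩
  obtain ⟨t, h0, h1, rfl⟩ := exists_convex_comb_of_mem_Ioo hz
  rw [← rpow_mul_rpow_const_mul_exp hC]
  refine le_trans ?_ (hg.2 x y t hx.1 hy.1 h0 h1)
  have hgx := hg.1 x hx.1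
  gcongr
  · exact hx.2
  · exact hy.2

lemma IsLogConvexOnPos.ordConnected_le_const_mul_exp (hg : IsLogConvexOnPos g) (hC : 0 ≤ C)
    (b : ℝ) : {t | 0 < t ∧ g t ≤ C * Real.exp (-b * t)}.OrdConnected := by
  refine Set.ordConnected_of_Ioo fun x hx y hy _ z hz => ⟨hx.1.trans hz.1, ?_⟩
  obtain ⟨t, h0, h1, rfl⟩ := exists_convex_comb_of_mem_Ioo hz
  rw [← rpow_mul_rpow_const_mul_exp hC]
  refine (hg.2 x y t hx.1 hy.1 h0 h1).trans ?_
  have hgx := hg.1 x hx.1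
  have hgy := hg.1 y hy.1
  gcongr
  · exact hx.2
  · exact hy.2

lemma indicator_Ioi_nonneg (hg : ∀ x, 0 < x → 0 ≤ g x) (t : ℝ) :
    0 ≤ (Set.Ioi 0).indicator g t :=
  Set.indicator_nonneg (fun x hx => hg x hx) t

/-- Measurability comes for free: superlevel sets at positive heights are intervals, by comparison
with an exponential of rate `0`. -/
lemma IsLogConcaveOnPos.measurable_indicator (hg : IsLogConcaveOnPos g) :
    Measurable ((Set.Ioi 0).indicator g) := by
  refine measurable_of_Ici fun c => ?_
  rcases le_or_gt c 0 with hc | hc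
  · convert MeasurableSet.univ
    exact Set.eq_univ_of_forall fun t => hc.trans (indicator_Ioi_nonneg hg.1 t)
  · convert (hg.ordConnected_const_mul_exp_le hc.le 0).measurableSet using 1
    ext t
    by_cases ht : 0 < t <;> simp [Set.indicator, ht, hc]

lemma IsLogConvexOnPos.measurable_indicator (hg : IsLogConvexOnPos g) :
    Measurable ((Set.Ioi 0).indicator g) := by
  refine measurable_of_Iic fun c => ?_
  rcases lt_or_ge c 0 with hc | hc
  · convert MeasurableSet.empty
    exact Set.eq_empty_of_forall_notMem fun t ht =>
      (hc.trans_le (indicator_Ioi_nonneg hg.1 t)).not_ge ht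
  · convert (measurableSet_Iic (a := (0 : ℝ))).union
      (hg.ordConnected_le_const_mul_exp hc 0).measurableSet using 1
    ext t
    by_cases ht : 0 < t
    · simp [Set.indicator, ht, ht.not_ge]
    · simp [Set.indicator, ht, hc, not_lt.1 ht]

/-- A log-concave function that decreases somewhere has an exponential majorant from then on. -/
lemma IsLogConcaveOnPos.exists_le_const_mul_exp (hg : IsLogConcaveOnPos g) {u v : ℝ} (hu : 0 < u)
    (huv : u < v) (h : g v < g u) :
    ∃ C b : ℝ, 0 ≤ C ∧ 0 < b ∧ ∀ t, v < t → g t ≤ C * Real.exp (-b * t) := by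
  have hgv := hg.1 v (hu.trans huv)
  -- The exponential passes through `(u, g u)` and `(v, m)`. The midpoint `m` is positive even when
  -- `g v = 0`, and exceeds `g v`. If `g` were above this exponential at some `t > v`, it would also
  -- be above it at `v`.
  set m := (g u + g v) / 2 with hm
  have hm0 : 0 < m := by linarith
  have hmu : m < g u := by linarith
  have hd : 0 < v - u := sub_pos.2 huv
  have hgu : 0 < g u := hm0.trans hmu
  set b := Real.log (g u / m) / (v - u) with hb
  have hb0 : 0 < b := div_pos (Real.log_pos ((one_lt_div hm0).2 hmu)) hd
  refine ⟨g u * Real.exp (b * u), b, by positivity, hb0, fun t ht => ?_⟩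
  have hI := hg.ordConnected_const_mul_exp_le (C := g u * Real.exp (b * u)) (by positivity) b
  have huI : g u * Real.exp (b * u) * Real.exp (-b * u) ≤ g u := by
    rw [mul_assoc, ← Real.exp_add]; simp
  have hvI : g v < g u * Real.exp (b * u) * Real.exp (-b * v) := by
    rw [mul_assoc, ← Real.exp_add, show b * u + -b * v = -(b * (v - u)) by ring, hb,
      div_mul_cancel₀ _ hd.ne', ← Real.log_inv, Real.exp_log (by positivity), inv_div,
      mul_div_cancel₀ _ hgu.ne']
    linarith
  by_contra! hcon
  have := hI.out (x := u) ⟨hu, huI⟩ (y := t) ⟨hu.trans (huv.trans ht), hcon.le⟩ ⟨huv.le, ht.le⟩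
  exact hvI.not_ge this.2

end Profiles

/-! ### Radial densities in the convex order -/

section Radial

variable {E : Type*} [NormedAddCommGroup E] [InnerProductSpace ℝ E] [FiniteDimensional ℝ E]
  [MeasurableSpace E] [BorelSpace E] {p q : ℝ → ℝ}

lemma ae_sq_norm_ne [Nontrivial E] (t : ℝ) : ∀ᵐ x : E, ‖x‖ ^ 2 ≠ t := by
  have h : (volume : Measure E) (Metric.sphere 0 √t) = 0 := Measure.addHaar_sphere _ _ _
  refine measure_mono_null (fun x hx => ?_) h
  have hx' : ‖x‖ ^ 2 = t := not_not.1 hx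
  simp [← hx']

variable (E) in
/-- The squared norm under the radial density `p` is smaller in the convex order than under the
radial density `q`. -/
def RadialConvexLE (p q : ℝ → ℝ) : Prop :=
  ∀ φ : ℝ → ℝ, Measurable φ → (∀ t, 0 ≤ t → 0 ≤ φ t) → ConvexOn ℝ (Set.Ici 0) φ →
    ∫⁻ x : E, ENNReal.ofReal (φ (‖x‖ ^ 2) * p (‖x‖ ^ 2)) ≤
      ∫⁻ x : E, ENNReal.ofReal (φ (‖x‖ ^ 2) * q (‖x‖ ^ 2))

lemma RadialConvexLE.lintegral_exp_inner_le [Nontrivial E] (h : RadialConvexLE E p q)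
    (hp : Measurable p) (hq : Measurable q) (ξ : E) :
    ∫⁻ x : E, ENNReal.ofReal (Real.exp (inner ℝ x ξ) * p (‖x‖ ^ 2)) ≤
      ∫⁻ x : E, ENNReal.ofReal (Real.exp (inner ℝ x ξ) * q (‖x‖ ^ 2)) := by
  have h0 : (volume : Measure E).toSphere Set.univ ≠ 0 := by
    rw [Ne, Measure.measure_univ_eq_zero]; exact Measure.toSphere_ne_zero _
  rw [← ENNReal.mul_le_mul_iff_right h0 (measure_ne_top _ _),
    toSphere_univ_mul_lintegral_exp_inner hp, toSphere_univ_mul_lintegral_exp_inner hq]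
  exact lintegral_mono fun θ => h (fun t => Real.cosh (inner ℝ (θ : E) ξ * √t)) (by fun_prop)
    (fun t _ => (Real.cosh_pos _).le) (convexOn_cosh_mul_sqrt _)

lemma RadialConvexLE.lintegral_exp_neg_mul_le (h : RadialConvexLE E p q) (b : ℝ) :
    ∫⁻ x : E, ENNReal.ofReal (Real.exp (-b * ‖x‖ ^ 2) * p (‖x‖ ^ 2)) ≤
      ∫⁻ x : E, ENNReal.ofReal (Real.exp (-b * ‖x‖ ^ 2) * q (‖x‖ ^ 2)) :=
  h _ (by fun_prop) (fun t _ => (Real.exp_pos _).le) (convexOn_exp_neg_mul b)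

lemma sq_div_two_le_cosh (x : ℝ) : x ^ 2 / 2 ≤ Real.cosh x := by
  refine (le_of_eq ?_).trans (le_hasSum (Real.hasSum_cosh x) 1 fun k _ => ?_)
  · norm_num
  · rw [pow_mul]; positivity

/-- Exponential moments of a radial density with infinite second moment are infinite. -/
lemma lintegral_exp_inner_eq_top [Nontrivial E] (hp : Measurable p) (hp0 : ∀ t, 0 ≤ p t)
    (hinf : ¬ Integrable fun x : E => ‖x‖ ^ 2 * p (‖x‖ ^ 2)) {ξ : E} (hξ : ξ ≠ 0) :
    ∫⁻ x : E, ENNReal.ofReal (Real.exp (inner ℝ x ξ) * p (‖x‖ ^ 2)) = ∞ := by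
  by_contra hne
  have h0 : (volume : Measure E).toSphere Set.univ ≠ 0 := by
    rw [Ne, Measure.measure_univ_eq_zero]; exact Measure.toSphere_ne_zero _
  have hfin := ENNReal.mul_ne_top (measure_ne_top (volume : Measure E).toSphere Set.univ) hne
  rw [toSphere_univ_mul_lintegral_exp_inner hp] at hfin
  have hmeas : Measurable fun θ : Metric.sphere (0 : E) 1 => ∫⁻ x : E,
      ENNReal.ofReal (Real.cosh (inner ℝ (θ : E) ξ * √(‖x‖ ^ 2)) * p (‖x‖ ^ 2)) :=
    Measurable.lintegral_prod_right' (f := fun z : Metric.sphere (0 : E) 1 × E =>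
      ENNReal.ofReal (Real.cosh (inner ℝ (z.1 : E) ξ * √(‖z.2‖ ^ 2)) * p (‖z.2‖ ^ 2)))
      (by fun_prop)
  -- In a direction with `c ≠ 0`, finiteness of the `cosh` integral would bound the second moment,
  -- since `cosh y ≥ y ^ 2 / 2`.
  have hperp : ∀ᵐ θ : Metric.sphere (0 : E) 1 ∂(volume : Measure E).toSphere,
      inner ℝ (θ : E) ξ = 0 := by
    filter_upwards [ae_lt_top hmeas hfin] with θ hθ
    by_contra hc
    set c := inner ℝ (θ : E) ξ
    refine hinf ?_
    have hint : Integrable fun x : E => Real.cosh (c * √(‖x‖ ^ 2)) * p (‖x‖ ^ 2) := by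
      refine ⟨by fun_prop, ?_⟩
      rw [hasFiniteIntegral_iff_ofReal (Filter.Eventually.of_forall fun x =>
        mul_nonneg (Real.cosh_pos _).le (hp0 _))]
      exact hθ
    refine (hint.const_mul (2 / c ^ 2)).mono' (by fun_prop)
      (Filter.Eventually.of_forall fun x => ?_)
    have hpx := hp0 (‖x‖ ^ 2)
    rw [Real.norm_of_nonneg (by positivity), ← mul_assoc]
    refine mul_le_mul_of_nonneg_right ?_ hpx
    have hcosh := sq_div_two_le_cosh (c * ‖x‖)
    rw [Real.sqrt_sq (norm_nonneg x)]
    calc ‖x‖ ^ 2 = 2 / c ^ 2 * ((c * ‖x‖) ^ 2 / 2) := by field_simp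
      _ ≤ _ := by gcongr
  -- Almost every direction being orthogonal to `ξ` is absurd: the averaging identity for a Gaussian
  -- would then give `exp (‖ξ‖ ^ 2 / 4) = 1`.
  have hgauss := toSphere_univ_mul_lintegral_exp_inner (measurable_gaussianProfile (E := E) 1) ξ
  have hmass := lintegral_exp_inner_mul_gaussianProfile (E := E) one_pos (0 : E)
  have hone : ∀ᵐ θ : Metric.sphere (0 : E) 1 ∂(volume : Measure E).toSphere,
      (∫⁻ x : E, ENNReal.ofReal
        (Real.cosh (inner ℝ (θ : E) ξ * √(‖x‖ ^ 2)) * gaussianProfile E 1 (‖x‖ ^ 2))) = 1 := by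
    filter_upwards [hperp] with θ hθ
    simpa [hθ] using hmass
  rw [lintegral_congr_ae hone, lintegral_exp_inner_mul_gaussianProfile one_pos,
    lintegral_one] at hgauss
  have h1 : ENNReal.ofReal (Real.exp (‖ξ‖ ^ 2 / (4 * 1))) = 1 := by
    rwa [ENNReal.mul_eq_left h0 (measure_ne_top _ _)] at hgauss
  rw [ENNReal.ofReal_eq_one, Real.exp_eq_one_iff] at h1
  have : 0 < ‖ξ‖ := norm_pos_iff.2 hξ
  have : 0 < ‖ξ‖ ^ 2 / (4 * 1) := by positivity
  exact this.ne' h1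

lemma RadialConvexLE.of_ordConnected [Nontrivial E] (hp0 : ∀ t, 0 ≤ p t) (hq0 : ∀ t, 0 ≤ q t)
    (hpi : Integrable fun x : E => p (‖x‖ ^ 2)) (hqi : Integrable fun x : E => q (‖x‖ ^ 2))
    (hsp : Integrable fun x : E => ‖x‖ ^ 2 * p (‖x‖ ^ 2))
    (hsq : Integrable fun x : E => ‖x‖ ^ 2 * q (‖x‖ ^ 2))
    (hmass : ∫ x : E, p (‖x‖ ^ 2) = ∫ x : E, q (‖x‖ ^ 2))
    (hmom : ∫ x : E, ‖x‖ ^ 2 * p (‖x‖ ^ 2) = ∫ x : E, ‖x‖ ^ 2 * q (‖x‖ ^ 2))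
    (hI : {t | 0 < t ∧ q t ≤ p t}.OrdConnected) : RadialConvexLE E p q := by
  intro φ hφm hφ0 hφ
  refine lintegral_convexOn_comp_mul_le (s := fun x : E => ‖x‖ ^ 2) (by fun_prop)
    (fun x => by positivity) ae_sq_norm_ne hpi hqi (fun x => hp0 _) (fun x => hq0 _) hsp hsq
    hmass hmom hI (Filter.Eventually.of_forall fun x hx => hx.2) ?_ hφm hφ0 hφ
  filter_upwards [ae_sq_norm_ne (E := E) 0] with x hx hx'
  have hpos : 0 < ‖x‖ ^ 2 := lt_of_le_of_ne (by positivity) hx.symm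
  by_contra! hcon
  exact hx' ⟨hpos, hcon.le⟩

/-- A radial probability density which is log-concave in the squared norm has a finite second
moment. -/
lemma IsLogConcaveOnPos.integrable_sq_norm_mul [Nontrivial E] {g : ℝ → ℝ}
    (hg : IsLogConcaveOnPos g) (hint : Integrable fun x : E => (Set.Ioi 0).indicator g (‖x‖ ^ 2))
    (hmass : ∫ x : E, (Set.Ioi 0).indicator g (‖x‖ ^ 2) ≠ 0) :
    Integrable fun x : E => ‖x‖ ^ 2 * (Set.Ioi 0).indicator g (‖x‖ ^ 2) := by
  -- Otherwise `g` is nondecreasing, hence bounded below by a positive constant outside a ball, and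
  -- is not integrable.
  obtain ⟨u, v, hu, huv, hlt⟩ : ∃ u v, 0 < u ∧ u < v ∧ g v < g u := by
    by_contra! hmono
    obtain ⟨t, ht, hgt⟩ : ∃ t, 0 < t ∧ 0 < g t := by
      by_contra! hz
      refine hmass ?_
      have : ∀ x : E, (Set.Ioi 0).indicator g (‖x‖ ^ 2) = 0 := fun x =>
        le_antisymm (Set.indicator_nonpos (fun t ht => hz t ht) _) (indicator_Ioi_nonneg hg.1 _)
      simp [this]
    have hfin := hint.measure_norm_ge_lt_top hgt
    have hsub : (Metric.closedBall (0 : E) √t)ᶜ ⊆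
        {x : E | g t ≤ ‖(Set.Ioi 0).indicator g (‖x‖ ^ 2)‖} := by
      intro x hx
      have hx' : √t < ‖x‖ := by simpa using hx
      have hx2 : t < ‖x‖ ^ 2 := by rwa [← Real.sqrt_lt' ((Real.sqrt_nonneg _).trans_lt hx')]
      rw [Set.mem_ofPred_eq, Set.indicator_of_mem (Set.mem_Ioi.2 (ht.trans hx2))]
      exact (hmono t _ ht hx2).trans (le_abs_self _)
    have h1 : (volume : Measure E) Set.univ < ∞ := by
      rw [← Set.union_compl_self (Metric.closedBall (0 : E) √t)]
      exact (measure_union_le _ _).trans_lt (ENNReal.add_lt_top.2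
        ⟨measure_closedBall_lt_top, (measure_mono hsub).trans_lt hfin⟩)
    have : NoncompactSpace E := NormedSpace.noncompactSpace ℝ E
    exact h1.ne (measure_univ_of_isAddLeftInvariant _)
  obtain ⟨C, b, hC, hb, hle⟩ := hg.exists_le_const_mul_exp hu huv hlt
  have hm := hg.measurable_indicator
  refine ((hint.const_mul v).add
    ((integrable_sq_norm_mul_exp_neg_mul_sq_norm (E := E) hb).const_mul C)).mono'
    (by fun_prop) (Filter.Eventually.of_forall fun x => ?_)
  have hgx := indicator_Ioi_nonneg hg.1 (‖x‖ ^ 2)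
  rw [Real.norm_of_nonneg (by positivity), Pi.add_apply]
  rcases le_or_gt (‖x‖ ^ 2) v with h | h
  · have h1 := mul_le_mul_of_nonneg_right h hgx
    have h2 : 0 ≤ C * (‖x‖ ^ 2 * Real.exp (-b * ‖x‖ ^ 2)) := by positivity
    linarith
  · have h1 := hle _ h
    have h0 : 0 < v := hu.trans huv
    rw [Set.indicator_of_mem (Set.mem_Ioi.2 (h0.trans h))] at hgx ⊢
    have h2 : ‖x‖ ^ 2 * g (‖x‖ ^ 2) ≤ ‖x‖ ^ 2 * (C * Real.exp (-b * ‖x‖ ^ 2)) := by gcongr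
    have h3 : 0 ≤ v * g (‖x‖ ^ 2) := by positivity
    linarith

end Radial

/-! ### Bounds on the Cramér transform -/

section Cramer

variable {E : Type*} [NormedAddCommGroup E] [InnerProductSpace ℝ E] [MeasurableSpace E]
  {μ : Measure E} {b : ℝ}

lemma exp_neg_cramerTransform_le (hb : 0 < b)
    (h : ∀ ξ : E, ∫⁻ x, ENNReal.ofReal (Real.exp (inner ℝ x ξ)) ∂μ ≤
      ENNReal.ofReal (Real.exp (‖ξ‖ ^ 2 / (4 * b)))) (x : E) :
    EReal.exp (-cramerTransform μ x) ≤ ENNReal.ofReal (Real.exp (-b * ‖x‖ ^ 2)) := by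
  rw [← EReal.exp_coe, EReal.exp_le_exp_iff, EReal.neg_le, ← EReal.coe_neg]
  -- The point `ξ = 2 b x` maximises `⟨x, ξ⟩ - ‖ξ‖ ^ 2 / (4 b)`.
  refine le_trans ?_ (le_iSup _ ((2 * b) • x))
  have hle : cumulantGen μ ((2 * b) • x) ≤ ((b * ‖x‖ ^ 2 : ℝ) : EReal) := by
    refine (ENNReal.log_monotone (h _)).trans_eq ?_
    rw [ENNReal.log_ofReal_of_pos (Real.exp_pos _), Real.log_exp, norm_smul,
      Real.norm_of_nonneg (by positivity)]
    congr 1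
    field_simp
    ring
  refine le_trans ?_ (EReal.sub_le_sub le_rfl hle)
  rw [← EReal.coe_sub, EReal.coe_le_coe_iff, real_inner_smul_right, real_inner_self_eq_norm_sq]
  linarith

lemma le_exp_neg_cramerTransform (hb : 0 < b)
    (h : ∀ ξ : E, ENNReal.ofReal (Real.exp (‖ξ‖ ^ 2 / (4 * b))) ≤
      ∫⁻ x, ENNReal.ofReal (Real.exp (inner ℝ x ξ)) ∂μ) (x : E) :
    ENNReal.ofReal (Real.exp (-b * ‖x‖ ^ 2)) ≤ EReal.exp (-cramerTransform μ x) := by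
  rw [← EReal.exp_coe, EReal.exp_le_exp_iff, EReal.le_neg, ← EReal.coe_neg]
  refine iSup_le fun ξ => ?_
  have hle : ((‖ξ‖ ^ 2 / (4 * b) : ℝ) : EReal) ≤ cumulantGen μ ξ := by
    refine le_trans (le_of_eq ?_) (ENNReal.log_monotone (h ξ))
    rw [ENNReal.log_ofReal_of_pos (Real.exp_pos _), Real.log_exp]
  refine (EReal.sub_le_sub le_rfl hle).trans ?_
  rw [← EReal.coe_sub, EReal.coe_le_coe_iff]
  -- By Cauchy–Schwarz the bound reduces to a perfect square in `‖x‖` and `‖ξ‖`.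
  have h1 := real_inner_le_norm x ξ
  have h2 : -(-b * ‖x‖ ^ 2) - (‖x‖ * ‖ξ‖ - ‖ξ‖ ^ 2 / (4 * b)) =
      (2 * b * ‖x‖ - ‖ξ‖) ^ 2 / (4 * b) := by
    field_simp; ring
  have h3 : 0 ≤ (2 * b * ‖x‖ - ‖ξ‖) ^ 2 / (4 * b) := by positivity
  linarith

/-- If no exponential moment is finite, the Cramér transform vanishes. -/
lemma one_le_exp_neg_cramerTransform [IsProbabilityMeasure μ]
    (h : ∀ ξ : E, ξ ≠ 0 → ∫⁻ x, ENNReal.ofReal (Real.exp (inner ℝ x ξ)) ∂μ = ∞) (x : E) :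
    1 ≤ EReal.exp (-cramerTransform μ x) := by
  rw [EReal.one_le_exp_iff, EReal.le_neg, neg_zero]
  refine iSup_le fun ξ => ?_
  by_cases hξ : ξ = 0
  · simp [hξ, cumulantGen]
  · simp [cumulantGen, h ξ hξ]

/-- Covers dimension zero, where the squared norm vanishes identically and there are no second
moments to match. -/
lemma expectedExpNegCramer_of_subsingleton [Subsingleton E] {Ω : Type*} [MeasurableSpace Ω]
    (P : Measure Ω) [IsProbabilityMeasure P] {X : Ω → E} (hX : AEMeasurable X P) :
    expectedExpNegCramer P X = 1 := by
  have := Measure.isProbabilityMeasure_map hX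
  have hin : ∀ x y : E, inner ℝ x y = 0 := fun x y => by
    rw [Subsingleton.elim x 0, inner_zero_left]
  simp [expectedExpNegCramer, cramerTransform, cumulantGen, hin]

end Cramer

/-! ### The comparison -/

section Comparison

variable {E : Type*} [NormedAddCommGroup E] [InnerProductSpace ℝ E] [FiniteDimensional ℝ E]
  [MeasurableSpace E] [BorelSpace E] {Ω : Type*} [MeasurableSpace Ω] {P : Measure Ω} {X : Ω → E}
  {p : ℝ → ℝ}

lemma lintegral_ofReal_withDensity_sq_norm (hp : Measurable p) {F : E → ℝ} (hF : Measurable F)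
    (hF0 : ∀ x, 0 ≤ F x) :
    ∫⁻ x, ENNReal.ofReal (F x) ∂(volume.withDensity fun x : E => ENNReal.ofReal (p (‖x‖ ^ 2))) =
      ∫⁻ x, ENNReal.ofReal (F x * p (‖x‖ ^ 2)) := by
  rw [lintegral_withDensity_eq_lintegral_mul _ (by fun_prop) (by fun_prop)]
  refine lintegral_congr fun x => ?_
  rw [Pi.mul_apply, ENNReal.ofReal_mul (hF0 x), mul_comm]

/-- Upper bound for `𝔼 exp (-Λ*(X))` by comparison with a Gaussian. -/
lemma expectedExpNegCramer_le_of_radialConvexLE [Nontrivial E] (hX : AEMeasurable X P)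
    (hp : Measurable p)
    (hlaw : P.map X = volume.withDensity fun x : E => ENNReal.ofReal (p (‖x‖ ^ 2)))
    {b : ℝ} (hb : 0 < b) (h : RadialConvexLE E p (gaussianProfile E b)) :
    expectedExpNegCramer P X ≤ (2 : ℝ≥0∞) ^ (-(Module.finrank ℝ E : ℝ) / 2) := by
  have hmgf : ∀ ξ : E, ∫⁻ x, ENNReal.ofReal (Real.exp (inner ℝ x ξ)) ∂(P.map X) ≤
      ENNReal.ofReal (Real.exp (‖ξ‖ ^ 2 / (4 * b))) := fun ξ => by
    rw [hlaw, lintegral_ofReal_withDensity_sq_norm hp (by fun_prop) fun x => (Real.exp_pos _).le,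
      ← lintegral_exp_inner_mul_gaussianProfile hb]
    exact h.lintegral_exp_inner_le hp (measurable_gaussianProfile b) ξ
  calc expectedExpNegCramer P X
      ≤ ∫⁻ ω, ENNReal.ofReal (Real.exp (-b * ‖X ω‖ ^ 2)) ∂P :=
        lintegral_mono fun ω => exp_neg_cramerTransform_le hb hmgf _
    _ = ∫⁻ x, ENNReal.ofReal (Real.exp (-b * ‖x‖ ^ 2)) ∂(P.map X) :=
        (lintegral_map' (f := fun x : E => ENNReal.ofReal (Real.exp (-b * ‖x‖ ^ 2)))
          (by fun_prop) hX).symm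
    _ ≤ _ := by
        rw [hlaw, lintegral_ofReal_withDensity_sq_norm hp (by fun_prop)
          fun x => (Real.exp_pos _).le, ← lintegral_exp_neg_mul_gaussianProfile hb]
        exact h.lintegral_exp_neg_mul_le b

/-- Lower bound for `𝔼 exp (-Λ*(X))` by comparison with a Gaussian. -/
lemma le_expectedExpNegCramer_of_radialConvexLE [Nontrivial E] (hX : AEMeasurable X P)
    (hp : Measurable p)
    (hlaw : P.map X = volume.withDensity fun x : E => ENNReal.ofReal (p (‖x‖ ^ 2)))
    {b : ℝ} (hb : 0 < b) (h : RadialConvexLE E (gaussianProfile E b) p) :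
    (2 : ℝ≥0∞) ^ (-(Module.finrank ℝ E : ℝ) / 2) ≤ expectedExpNegCramer P X := by
  have hmgf : ∀ ξ : E, ENNReal.ofReal (Real.exp (‖ξ‖ ^ 2 / (4 * b))) ≤
      ∫⁻ x, ENNReal.ofReal (Real.exp (inner ℝ x ξ)) ∂(P.map X) := fun ξ => by
    rw [hlaw, lintegral_ofReal_withDensity_sq_norm hp (by fun_prop) fun x => (Real.exp_pos _).le,
      ← lintegral_exp_inner_mul_gaussianProfile hb]
    exact h.lintegral_exp_inner_le (measurable_gaussianProfile b) hp ξ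
  calc (2 : ℝ≥0∞) ^ (-(Module.finrank ℝ E : ℝ) / 2)
      ≤ ∫⁻ x, ENNReal.ofReal (Real.exp (-b * ‖x‖ ^ 2)) ∂(P.map X) := by
        rw [hlaw, lintegral_ofReal_withDensity_sq_norm hp (by fun_prop)
          fun x => (Real.exp_pos _).le, ← lintegral_exp_neg_mul_gaussianProfile hb]
        exact h.lintegral_exp_neg_mul_le b
    _ = ∫⁻ ω, ENNReal.ofReal (Real.exp (-b * ‖X ω‖ ^ 2)) ∂P :=
        lintegral_map' (f := fun x : E => ENNReal.ofReal (Real.exp (-b * ‖x‖ ^ 2)))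
          (by fun_prop) hX
    _ ≤ expectedExpNegCramer P X :=
        lintegral_mono fun ω => le_exp_neg_cramerTransform hb hmgf _

/-- The Gaussian value `𝔼 exp (-Λ*(G)) = 2 ^ (-d / 2)`. -/
lemma expectedExpNegCramer_stdGaussian (hX : HasLaw X (stdGaussian E) P) :
    expectedExpNegCramer P X = (2 : ℝ≥0∞) ^ (-(Module.finrank ℝ E : ℝ) / 2) := by
  have hb : (0 : ℝ) < 1 / 2 := by norm_num
  have hmgf : ∀ ξ : E, ∫⁻ x, ENNReal.ofReal (Real.exp (inner ℝ x ξ)) ∂(P.map X) =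
      ENNReal.ofReal (Real.exp (‖ξ‖ ^ 2 / (4 * (1 / 2)))) := fun ξ => by
    rw [hX.map_eq, stdGaussian_eq_withDensity, lintegral_ofReal_withDensity_sq_norm
      (measurable_gaussianProfile _) (by fun_prop) fun x => (Real.exp_pos _).le,
      lintegral_exp_inner_mul_gaussianProfile hb]
  have hval : ∀ x : E, EReal.exp (-cramerTransform (P.map X) x) =
      ENNReal.ofReal (Real.exp (-(1 / 2) * ‖x‖ ^ 2)) := fun x =>
    le_antisymm (exp_neg_cramerTransform_le hb (fun ξ => (hmgf ξ).le) x)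
      (le_exp_neg_cramerTransform hb (fun ξ => (hmgf ξ).ge) x)
  simp only [expectedExpNegCramer, hval]
  rw [← lintegral_map' (f := fun x : E => ENNReal.ofReal (Real.exp (-(1 / 2) * ‖x‖ ^ 2)))
    (by fun_prop) hX.aemeasurable, hX.map_eq, stdGaussian_eq_withDensity,
    lintegral_ofReal_withDensity_sq_norm (measurable_gaussianProfile _) (by fun_prop)
      fun x => (Real.exp_pos _).le, lintegral_exp_neg_mul_gaussianProfile hb]

/-- The origin is a null set, so the uncontrolled value `f 0` can be replaced by `0`; the resulting
profile is nonnegative everywhere whenever `f` is so on `(0, ∞)`. -/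
lemma withDensity_norm_eq_withDensity_sq_norm [Nontrivial E] (f : ℝ → ℝ) :
    (volume.withDensity fun x : E => ENNReal.ofReal (f ‖x‖)) = volume.withDensity fun x : E =>
      ENNReal.ofReal ((Set.Ioi 0).indicator (fun t => f √t) (‖x‖ ^ 2)) := by
  refine withDensity_congr_ae ?_
  filter_upwards [ae_sq_norm_ne (E := E) 0] with x hx
  have hpos : 0 < ‖x‖ ^ 2 := lt_of_le_of_ne (by positivity) hx.symm
  rw [Set.indicator_of_mem (Set.mem_Ioi.2 hpos), Real.sqrt_sq (norm_nonneg x)]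

lemma integrable_and_integral_eq_one (hp : Measurable p) (hp0 : ∀ t, 0 ≤ p t)
    [IsProbabilityMeasure (volume.withDensity fun x : E => ENNReal.ofReal (p (‖x‖ ^ 2)))] :
    (Integrable fun x : E => p (‖x‖ ^ 2)) ∧ ∫ x : E, p (‖x‖ ^ 2) = 1 := by
  have h : ∫⁻ x : E, ENNReal.ofReal (p (‖x‖ ^ 2)) = 1 := by
    rw [← setLIntegral_univ, ← withDensity_apply _ MeasurableSet.univ, measure_univ]
  have hi : Integrable fun x : E => p (‖x‖ ^ 2) := by
    refine ⟨(hp.comp (measurable_norm.pow_const 2)).aestronglyMeasurable, ?_⟩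
    rw [hasFiniteIntegral_iff_ofReal (Filter.Eventually.of_forall fun x => hp0 _), h]
    exact ENNReal.one_lt_top
  refine ⟨hi, ?_⟩
  rw [integral_eq_lintegral_of_nonneg_ae (Filter.Eventually.of_forall fun x => hp0 _) hi.1, h,
    ENNReal.toReal_one]

/-- Some Gaussian density has the same second moment as a given radial density. -/
lemma exists_gaussianProfile_second_moment_eq [Nontrivial E] (hp0 : ∀ t, 0 ≤ p t)
    (hmass : ∫ x : E, p (‖x‖ ^ 2) = 1) (hsp : Integrable fun x : E => ‖x‖ ^ 2 * p (‖x‖ ^ 2)) :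
    ∃ b : ℝ, 0 < b ∧ ∫ x : E, ‖x‖ ^ 2 * p (‖x‖ ^ 2) =
      ∫ x : E, ‖x‖ ^ 2 * gaussianProfile E b (‖x‖ ^ 2) := by
  obtain ⟨M, hM, hMb⟩ := exists_integral_sq_norm_mul_gaussianProfile (E := E)
  have hnn : ∀ x : E, 0 ≤ ‖x‖ ^ 2 * p (‖x‖ ^ 2) := fun x => mul_nonneg (by positivity) (hp0 _)
  have hpos : 0 < ∫ x : E, ‖x‖ ^ 2 * p (‖x‖ ^ 2) := by
    refine lt_of_le_of_ne (integral_nonneg hnn) fun h => ?_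
    have hz := (integral_eq_zero_iff_of_nonneg hnn hsp).1 h.symm
    have hz' : (fun x : E => p (‖x‖ ^ 2)) =ᵐ[volume] fun _ => 0 := by
      filter_upwards [hz, ae_sq_norm_ne (E := E) 0] with x h1 h2
      exact (mul_eq_zero.1 h1).resolve_left h2
    rw [integral_congr_ae hz', integral_zero] at hmass
    exact zero_ne_one hmass
  refine ⟨M / ∫ x : E, ‖x‖ ^ 2 * p (‖x‖ ^ 2), div_pos hM hpos, ?_⟩
  rw [hMb _ (div_pos hM hpos)]
  field_simp

variable [IsProbabilityMeasure P] {f : ℝ → ℝ}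

theorem expectedExpNegCramer_le_of_mem_LCconc [Nontrivial E] (hX : AEMeasurable X P)
    (hlaw : P.map X = volume.withDensity fun x : E => ENNReal.ofReal (f ‖x‖)) (hf : f ∈ LCconc) :
    expectedExpNegCramer P X ≤ (2 : ℝ≥0∞) ^ (-(Module.finrank ℝ E : ℝ) / 2) := by
  have hg : IsLogConcaveOnPos fun t => f √t := hf
  have hprob := Measure.isProbabilityMeasure_map hX
  rw [withDensity_norm_eq_withDensity_sq_norm] at hlaw
  rw [hlaw] at hprob
  have hp := hg.measurable_indicator
  have hp0 := indicator_Ioi_nonneg hg.1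
  obtain ⟨hpi, hmass⟩ := integrable_and_integral_eq_one (E := E) hp hp0
  have hsp := hg.integrable_sq_norm_mul hpi (by rw [hmass]; exact one_ne_zero)
  obtain ⟨b, hb, hmom⟩ := exists_gaussianProfile_second_moment_eq hp0 hmass hsp
  refine expectedExpNegCramer_le_of_radialConvexLE hX hp hlaw hb
    (.of_ordConnected hp0 (fun t => (gaussianProfile_pos hb t).le) hpi
      (integrable_gaussianProfile hb) hsp (integrable_sq_norm_mul_gaussianProfile hb)
      (hmass.trans (integral_gaussianProfile hb).symm) hmom ?_)
  have hC : 0 ≤ (b / Real.pi) ^ (Module.finrank ℝ E / 2 : ℝ) :=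
    Real.rpow_nonneg (div_nonneg hb.le Real.pi_pos.le) _
  convert hg.ordConnected_const_mul_exp_le hC b using 1
  ext t
  simp +contextual [Set.indicator, gaussianProfile]

theorem le_expectedExpNegCramer_of_mem_LCconv [Nontrivial E] (hX : AEMeasurable X P)
    (hlaw : P.map X = volume.withDensity fun x : E => ENNReal.ofReal (f ‖x‖)) (hf : f ∈ LCconv) :
    (2 : ℝ≥0∞) ^ (-(Module.finrank ℝ E : ℝ) / 2) ≤ expectedExpNegCramer P X := by
  have hg : IsLogConvexOnPos fun t => f √t := hf
  have hprob := Measure.isProbabilityMeasure_map hX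
  rw [withDensity_norm_eq_withDensity_sq_norm] at hlaw
  have hp := hg.measurable_indicator
  have hp0 := indicator_Ioi_nonneg hg.1
  -- A log-convex profile may have a heavy tail, so an infinite second moment has to be treated
  -- separately.
  by_cases hsp : Integrable fun x : E =>
      ‖x‖ ^ 2 * (Set.Ioi 0).indicator (fun t => f √t) (‖x‖ ^ 2)
  · rw [hlaw] at hprob
    obtain ⟨hpi, hmass⟩ := integrable_and_integral_eq_one (E := E) hp hp0
    obtain ⟨b, hb, hmom⟩ := exists_gaussianProfile_second_moment_eq hp0 hmass hsp
    refine le_expectedExpNegCramer_of_radialConvexLE hX hp hlaw hb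
      (.of_ordConnected (fun t => (gaussianProfile_pos hb t).le) hp0
        (integrable_gaussianProfile hb) hpi (integrable_sq_norm_mul_gaussianProfile hb) hsp
        ((integral_gaussianProfile hb).trans hmass.symm) hmom.symm ?_)
    have hC : 0 ≤ (b / Real.pi) ^ (Module.finrank ℝ E / 2 : ℝ) :=
      Real.rpow_nonneg (div_nonneg hb.le Real.pi_pos.le) _
    convert hg.ordConnected_le_const_mul_exp hC b using 1
    ext t
    simp +contextual [Set.indicator, gaussianProfile]
  · have hmgf : ∀ ξ : E, ξ ≠ 0 →
        ∫⁻ x, ENNReal.ofReal (Real.exp (inner ℝ x ξ)) ∂(P.map X) = ∞ := fun ξ hξ => by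
      rw [hlaw, lintegral_ofReal_withDensity_sq_norm hp (by fun_prop)
        fun x => (Real.exp_pos _).le]
      exact lintegral_exp_inner_eq_top hp hp0 hsp hξ
    calc (2 : ℝ≥0∞) ^ (-(Module.finrank ℝ E : ℝ) / 2) ≤ 1 :=
          ENNReal.rpow_le_one_of_one_le_of_neg one_le_two
            (div_neg_of_neg_of_pos (neg_neg_of_pos (Nat.cast_pos.2 Module.finrank_pos)) two_pos)
      _ = ∫⁻ _, 1 ∂P := by simp
      _ ≤ expectedExpNegCramer P X :=
          lintegral_mono fun ω => one_le_exp_neg_cramerTransform hmgf _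

end Comparison

theorem theorem3 {n : ℕ}
    {Ω : Type*} [MeasurableSpace Ω] (P : Measure Ω) [IsProbabilityMeasure P]
    (X : Ω → EuclideanSpace ℝ (Fin n)) (hX : AEMeasurable X P)
    (hrot : IsRotationallyInvariant (P.map X)) (hlc : IsLogConcaveMeasure (P.map X))
    (f : ℝ → ℝ) (hf : HasRadialDensity P X f)
    {Ω' : Type*} [MeasurableSpace Ω'] (Q : Measure Ω') [IsProbabilityMeasure Q]
    (G : Ω' → EuclideanSpace ℝ (Fin n))
    (hG : HasLaw G (stdGaussian (EuclideanSpace ℝ (Fin n))) Q) :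
    (f ∈ LCconv → expectedExpNegCramer Q G ≤ expectedExpNegCramer P X) ∧
    (f ∈ LCconc → expectedExpNegCramer P X ≤ expectedExpNegCramer Q G) ∧
    expectedExpNegCramer Q G = (2 : ℝ≥0∞) ^ (-(n : ℝ) / 2) ∧
    (f ∈ LCconc → expectedExpNegCramer P X ≤ (2 : ℝ≥0∞) ^ (-(n : ℝ) / 2)) := by
  have hgauss : expectedExpNegCramer Q G = (2 : ℝ≥0∞) ^ (-(n : ℝ) / 2) := by
    rw [expectedExpNegCramer_stdGaussian hG, finrank_euclideanSpace_fin]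
  have hone : n = 0 → expectedExpNegCramer P X = (2 : ℝ≥0∞) ^ (-(n : ℝ) / 2) := by
    rintro rfl
    rw [expectedExpNegCramer_of_subsingleton P hX]
    simp
  have hnt : n ≠ 0 → Nontrivial (EuclideanSpace ℝ (Fin n)) := fun hn =>
    Module.nontrivial_of_finrank_pos (R := ℝ) (by
      rw [finrank_euclideanSpace_fin]; exact Nat.pos_of_ne_zero hn)
  have hconv : f ∈ LCconv → (2 : ℝ≥0∞) ^ (-(n : ℝ) / 2) ≤ expectedExpNegCramer P X := by
    intro h
    by_cases hn : n = 0
    · exact (hone hn).ge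
    · have := hnt hn
      simpa using le_expectedExpNegCramer_of_mem_LCconv hX hf h
  have hconc : f ∈ LCconc → expectedExpNegCramer P X ≤ (2 : ℝ≥0∞) ^ (-(n : ℝ) / 2) := by
    intro h
    by_cases hn : n = 0
    · exact (hone hn).le
    · have := hnt hn
      simpa using expectedExpNegCramer_le_of_mem_LCconc hX hf h
  exact ⟨fun h => hgauss ▸ hconv h, fun h => hgauss ▸ hconc h, hgauss, hconc⟩
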